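/- Let $N\ge 1$, $L\ge 1$ be integers and let $\underline{c}=(c_0,\ldots,c_{N-1})$ be real or complex numbers, with $\|\underline{c}\|_1=\sum_{n=0}^{N-1}|c_n|$. Let $x_0^{leg}>x_1^{leg}>\cdots>x_{N-1}^{leg}$ be the $N$ roots of the degree $N$ Legendre polynomial $P_N$ (all of which lie in $(-1,1)$), let $\theta_k^{leg}=\arccos x_k^{leg}$, and let $$f_k=\sum_{n=0}^{N-1}c_n T_n(x_k^{leg}),\qquad 0\le k\le N-1,$$ where $T_n$ is the degree $n$ Chebyshev polynomial of the first kind. For a grid $\theta_0^\ast,\ldots,\theta_{N-1}^\ast$ of Taylor centres put $\delta\theta_k=\theta_k^{leg}-\theta_k^\ast$ and let $$f_{k,L,\delta\theta_k}=\sum_{\ell=0}^{L-1}(-1)^{\lfloor(\ell+1)/2\rfloor}\frac{\delta\theta_k^{\ell}}{\ell!}\sum_{n=0}^{N-1}(n^\ell c_n)\,\Phi_\ell(n\theta_k^\ast),\qquad 0\le k\le N-1,$$ where $0^0=1$, and $\Phi_\ell(\theta)=\cos\theta$ for even $\ell$ and $\Phi_\ell(\theta)=\sin\theta$ for odd $\ell$;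 this is the $L$-term truncated non-uniform discrete cosine transform (NDCT). If $\theta_k^\ast=\theta_k^{cheb_1}:=\dfrac{(k+\frac12)\pi}{N}$ for $0\le k\le N-1$, then $$\max_{0\le k\le N-1}|f_k-f_{k,L,\delta\theta_k}|\le\frac{(0.83845)^L}{L!}\|\underline{c}\|_1.$$ If $\theta_k^\ast=\theta_k^{cheb_\ast}:=\dfrac{(k+\frac34)\pi}{N+\frac12}$ for $0\le k\le N-1$, then $$\max_{0\le k\le N-1}|f_k-f_{k,L,\delta\theta_k}|\le\frac{1}{(6\pi)^L\,L!}\|\underline{c}\|_1.$$ In both bounds the factor multiplying $\|\underline{c}\|_1$ is independent of $N$. -/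

import Mathlib

noncomputable section

namespace NDCT

/-- The Legendre polynomial `P_N` (Rodrigues' formula, normalised by `P_N(1) = 1`):
`P_N = 1 / (2 ^ N * N!) * (d/dx)^N (x ^ 2 - 1) ^ N`. -/
def legendre (N : ℕ) : Polynomial ℝ :=
  Polynomial.C (1 / ((2 : ℝ) ^ N * (N.factorial : ℝ))) *
    (Polynomial.derivative^[N] ((Polynomial.X ^ 2 - 1) ^ N))

/-- The Legendre node `x_k`: entry number `k` (counted from `0`) in the list of the real roots of
`P_N` in decreasing order. As `P_N` has `N` distinct real roots, all of them in `(-1, 1)`, the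
default value `0` of `List.getD` is not reached for `k < N`. -/
def legendreNode (N : ℕ) (k : Fin N) : ℝ :=
  ((legendre N).roots.sort (· ≥ ·)).getD (k : ℕ) 0

/-- The transformed Legendre node `θ_k = arccos x_k`. -/
def thetaLeg (N : ℕ) (k : Fin N) : ℝ :=
  Real.arccos (legendreNode N k)

/-- The angles of the Chebyshev points of the first kind, `(k + 1/2) π / N`. -/
def thetaCheb1 (N : ℕ) (k : Fin N) : ℝ :=
  (((k : ℕ) : ℝ) + 1 / 2) * Real.pi / (N : ℝ)

/-- The Chebyshev-like grid `(k + 3/4) π / (N + 1/2)`. -/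
def thetaChebStar (N : ℕ) (k : Fin N) : ℝ :=
  (((k : ℕ) : ℝ) + 3 / 4) * Real.pi / ((N : ℝ) + 1 / 2)

/-- The non-uniform discrete cosine transform: the value at the Legendre node `x_k` of the
Chebyshev expansion with coefficients `c`, `f_k = ∑ n, c_n T_n(x_k)`. -/
def ndct {𝕜 : Type*} [RCLike 𝕜] {N : ℕ} (c : Fin N → 𝕜) (k : Fin N) : 𝕜 :=
  ∑ n : Fin N,
    c n * (((Polynomial.Chebyshev.T ℝ ((n : ℕ) : ℤ)).eval (legendreNode N k) : ℝ) : 𝕜)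

/-- `Φ_l` is the cosine for even `l` and the sine for odd `l`. -/
def Phi (l : ℕ) (t : ℝ) : ℝ :=
  if Even l then Real.cos t else Real.sin t

/-- The `L`-term truncated transform with Taylor centres `θ`, where `δ_k = θ_k^leg - θ_k`:
`∑ l < L, (-1) ^ ⌊(l + 1) / 2⌋ * (δ_k ^ l / l!) * ∑ n, (n ^ l c_n) Φ_l(n θ_k)`. -/
def ndctTaylor {𝕜 : Type*} [RCLike 𝕜] {N : ℕ} (L : ℕ) (θ : Fin N → ℝ) (c : Fin N → 𝕜)
    (k : Fin N) : 𝕜 :=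
  ∑ l ∈ Finset.range L,
    (((-1 : ℝ) ^ ((l + 1) / 2) * ((thetaLeg N k - θ k) ^ l / (l.factorial : ℝ)) : ℝ) : 𝕜) *
      ∑ n : Fin N, ((((n : ℕ) : 𝕜) ^ l * c n) * ((Phi l (((n : ℕ) : ℝ) * θ k) : ℝ) : 𝕜))

/-- The norm `‖c‖₁`. -/
def norm1 {𝕜 : Type*} [RCLike 𝕜] {N : ℕ} (c : Fin N → 𝕜) : ℝ :=
  ∑ n : Fin N, ‖c n‖

end NDCT

end

noncomputable section

open Polynomial Set

namespace NDCT

/-! Since `T_n(cos θ) = cos nθ`, truncation after `L` terms costs at most `|n δθ_k|^L / L!` per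
coefficient, so it suffices to bound `(N - 1) |δθ_k|` uniformly in `N` and `k`.

Put `l = N + 1/2`. The function `u(t) = √(sin t) P_N(cos t)` solves `u'' + q u = 0` with `q = l² +
1/(4 sin² t)`. Two Sturm comparisons (`sturm_picone`) locate its zeros. As `q > l²`, consecutive
angles are at most `π / l` apart; with the symmetry `θ ↦ π - θ` this gives `θ_k ≥ θ_k^*` in the left
half, where `θ_k^* = (k + 3/4) π / l`. Conversely, `φ'^(-1/2) sin(φ + c)` with `φ = l (t - π/2) -
cot t / (8 l)` solves an equation with coefficient larger than `q` (`lt_phaseQ`), so `φ` grows by at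
least `π` between zeros. As `φ` is odd about `π/2`, it follows that `θ_k ≤ θ_k^* + cot θ_k / (8
l²)`, and the excess is at most `1 / (6 π l)`. The first-kind Chebyshev grid differs from `θ_k^*` by
at most a further `π / (4 l)`. -/

/-! ### Zeros of the derivatives of `(X² - 1)^N` -/

/-- Rolle's theorem for a strictly increasing family of zeros. -/
theorem exists_strictMono_derivative_roots (p : ℝ[X]) {n : ℕ} (z : Fin (n + 1) → ℝ)
    (hz : StrictMono z) (h0 : ∀ i, p.eval (z i) = 0) :
    ∃ y : Fin n → ℝ, StrictMono y ∧
      ∀ i, (z i.castSucc < y i ∧ y i < z i.succ) ∧ (derivative p).eval (y i) = 0 := by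
  have h : ∀ i : Fin n, ∃ t, (z i.castSucc < t ∧ t < z i.succ) ∧ (derivative p).eval t = 0 := by
    intro i
    obtain ⟨t, ht, h⟩ := exists_hasDerivAt_eq_zero (f := fun x => p.eval x)
      (f' := fun x => (derivative p).eval x) (hz (Fin.castSucc_lt_succ (i := i)))
      p.continuous.continuousOn (by simp [h0]) (fun x _ => p.hasDerivAt x)
    exact ⟨t, ⟨ht.1, ht.2⟩, h⟩
  choose y hy using h
  refine ⟨y, fun i j hij => ?_, hy⟩
  calc y i < z i.succ := (hy i).1.2
    _ ≤ z j.castSucc := hz.monotone (by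
      rw [Fin.le_def, Fin.val_succ, Fin.val_castSucc]; exact hij)
    _ < y j := (hy j).1.1

theorem eval_iterate_derivative_sq_sub_one {N m : ℕ} (hm : m < N) {x : ℝ} (hx : x ^ 2 = 1) :
    (derivative^[m] ((X ^ 2 - 1 : ℝ[X]) ^ N)).eval x = 0 := by
  have h : (X ^ 2 - 1 : ℝ[X]) ^ (N - m) ∣ derivative^[m] ((X ^ 2 - 1 : ℝ[X]) ^ N) :=
    pow_sub_dvd_iterate_derivative_of_pow_dvd m dvd_rfl
  obtain ⟨r, hr⟩ := h
  rw [hr]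
  simp [hx, Nat.sub_eq_zero_iff_le, hm]

/-- Induction on `m`: for `m < N` the endpoints `±1` are still zeros of the `m`-th derivative, so
Rolle on `m + 2` zeros yields `m + 1` interior ones. -/
theorem exists_strictMono_roots_iterate_derivative (N m : ℕ) (hm : m ≤ N) :
    ∃ z : Fin m → ℝ, StrictMono z ∧ (∀ i, -1 < z i ∧ z i < 1) ∧
      ∀ i, (derivative^[m] ((X ^ 2 - 1 : ℝ[X]) ^ N)).eval (z i) = 0 := by
  induction m with
  | zero => exact ⟨Fin.elim0, fun i => i.elim0, fun i => i.elim0, fun i => i.elim0⟩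
  | succ m ih =>
    obtain ⟨z, hz, hb, h0⟩ := ih (by omega)
    let w : Fin (m + 2) → ℝ := Fin.cons (-1) (Fin.snoc z 1 : Fin (m + 1) → ℝ)
    have hw : StrictMono w := by
      refine Fin.strictMono_cons.2 ⟨fun j => ?_, ?_⟩
      · refine Fin.lastCases ?_ (fun k => ?_) j
        · simp
        · simpa using (hb k).1
      · intro i j
        refine Fin.lastCases (fun h => absurd h (Fin.le_last j).not_gt) (fun k => ?_) i
        refine Fin.lastCases (fun _ => ?_) (fun l h => ?_) j
        · simpa using (hb k).2
        · simpa using hz (Fin.castSucc_lt_castSucc_iff.1 h)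
    have hw0 : ∀ i, (derivative^[m] ((X ^ 2 - 1 : ℝ[X]) ^ N)).eval (w i) = 0 := by
      intro i
      refine Fin.cases ?_ (fun j => ?_) i
      · exact eval_iterate_derivative_sq_sub_one (by omega) (by simp [w])
      · refine Fin.lastCases ?_ (fun k => ?_) j
        · exact eval_iterate_derivative_sq_sub_one (by omega) (by simp [w])
        · simpa [w] using h0 k
    obtain ⟨y, hy, hyz⟩ := exists_strictMono_derivative_roots _ w hw hw0
    refine ⟨y, hy, fun i => ⟨?_, ?_⟩, fun i => ?_⟩
    · refine lt_of_le_of_lt ?_ (hyz i).1.1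
      have := hw.monotone (Fin.zero_le i.castSucc)
      simpa [w] using this
    · refine lt_of_lt_of_le (hyz i).1.2 ?_
      have := hw.monotone (Fin.le_last i.succ)
      simpa [w, ← Fin.succ_last] using this
    · rw [Function.iterate_succ_apply']
      exact (hyz i).2

theorem natDegree_legendre_le (N : ℕ) : (legendre N).natDegree ≤ N := by
  refine (natDegree_C_mul_le _ _).trans ((natDegree_iterate_derivative _ _).trans ?_)
  have : ((X ^ 2 - 1 : ℝ[X]) ^ N).natDegree ≤ N * 2 := by
    refine natDegree_pow_le.trans (Nat.mul_le_mul_left _ ?_)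
    compute_degree
  omega

theorem legendre_ne_zero (N : ℕ) : legendre N ≠ 0 := by
  have hd : ((X ^ 2 - 1 : ℝ[X]) ^ N).natDegree = N * 2 := by
    rw [natDegree_pow]; congr 1; compute_degree!
  have hc : ((X ^ 2 - 1 : ℝ[X]) ^ N) ≠ 0 := by
    apply pow_ne_zero
    intro h
    have := congrArg (eval 0) h
    simp at this
  refine mul_ne_zero (by simp [Nat.factorial_ne_zero]) ?_
  intro h
  -- The coefficient of `X^N` in the `N`-th derivative is a positive multiple of the leading
  -- coefficient of `(X² - 1)^N`.
  have := congrArg (fun q => coeff q N) h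
  simp only [coeff_iterate_derivative, coeff_zero] at this
  rw [show N + N = ((X ^ 2 - 1 : ℝ[X]) ^ N).natDegree by omega, coeff_natDegree] at this
  simp only [nsmul_eq_mul, mul_eq_zero, leadingCoeff_eq_zero, hc, or_false, Nat.cast_eq_zero,
    Nat.descFactorial_eq_zero_iff_lt, hd] at this
  omega

/-! ### Differential equation and parity of `P_N` -/

/-- The Legendre differential equation. -/
theorem legendre_ode (N : ℕ) (x : ℝ) :
    (1 - x ^ 2) * (derivative (derivative (legendre N))).eval x -
      2 * x * (derivative (legendre N)).eval x + N * (N + 1) * (legendre N).eval x = 0 := by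
  set y : ℕ → ℝ[X] := fun m => derivative^[m] ((X ^ 2 - 1 : ℝ[X]) ^ N) with hy
  have hs : ∀ m, derivative (y m) = y (m + 1) := fun m =>
    (Function.iterate_succ_apply' derivative m _).symm
  -- This is `(X² - 1) y' = 2 N X y` differentiated `m + 1` times; `m = N` gives the Legendre
  -- equation up to sign and normalisation.
  have key : ∀ m : ℕ, (X ^ 2 - 1) * y (m + 2) + (2 * (m + 1) - 2 * N : ℝ[X]) * X * y (m + 1) +
      ((m + 1) * m - 2 * N * (m + 1) : ℝ[X]) * y m = 0 := by
    have h0 : (X ^ 2 - 1) * y 1 = (2 * N : ℝ[X]) * X * y 0 := by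
      rcases N with _ | n
      · simp [hy]
      · simp [hy, derivative_pow, C_ofNat]
        ring
    intro m
    induction m with
    | zero =>
      have := congrArg derivative h0
      simp [hs] at this
      push_cast
      linear_combination this
    | succ m ih =>
      have := congrArg derivative ih
      simp [hs] at this
      push_cast
      linear_combination this
  have h := congrArg (eval x) (key N)
  simp at h
  have e : ∀ m, derivative^[m] (legendre N) =
      C (1 / ((2 : ℝ) ^ N * (N.factorial : ℝ))) * y (N + m) := by
    intro m
    rw [legendre, iterate_derivative_C_mul, add_comm N m, ← Function.iterate_add_apply]
  have e0 := e 0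
  have e1 := e 1
  have e2 := e 2
  simp only [Function.iterate_zero, id, Function.iterate_succ, Function.comp_apply] at e0 e1 e2
  rw [e2, e1, e0]
  simp only [eval_mul, eval_C, add_zero]
  linear_combination (-(1 / ((2 : ℝ) ^ N * (N.factorial : ℝ)))) * h

theorem legendre_comp_neg (N : ℕ) (x : ℝ) :
    (legendre N).eval (-x) = (-1) ^ N * (legendre N).eval x := by
  have h : ∀ m, (derivative^[m] ((X ^ 2 - 1 : ℝ[X]) ^ N)).comp (-X) =
      (-1) ^ m * derivative^[m] ((X ^ 2 - 1 : ℝ[X]) ^ N) := by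
    intro m
    induction m with
    | zero => simp
    | succ m ih =>
      have := congrArg derivative ih
      rw [derivative_comp] at this
      have h1 : derivative ((-1 : ℝ[X]) ^ m) = 0 := by
        rw [show (-1 : ℝ[X]) ^ m = C ((-1) ^ m) by simp]; exact derivative_C
      simp only [derivative_mul, h1, derivative_neg, derivative_X] at this
      rw [Function.iterate_succ_apply', pow_succ (-1 : ℝ[X]) m]
      linear_combination -this
  have := congrArg (eval x) (h N)
  simp only [eval_comp, eval_neg, eval_X, eval_mul, eval_pow, eval_one] at this
  simp only [legendre, eval_mul, eval_C, this]
  ring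

/-! ### The Legendre nodes and their angles -/

theorem card_roots_legendre (N : ℕ) :
    (legendre N).roots.Nodup ∧ (legendre N).roots.card = N ∧
      ∀ x ∈ (legendre N).roots, -1 < x ∧ x < 1 := by
  obtain ⟨z, hz, hb, h0⟩ := exists_strictMono_roots_iterate_derivative N N le_rfl
  have hsub : Finset.univ.image z ⊆ (legendre N).roots.toFinset := by
    intro x hx
    obtain ⟨i, -, rfl⟩ := Finset.mem_image.1 hx
    rw [Multiset.mem_toFinset, mem_roots (legendre_ne_zero N), IsRoot, legendre, eval_mul, h0,
      mul_zero]
  have hcard : (Finset.univ.image z).card = N := by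
    rw [Finset.card_image_of_injective _ hz.injective, Finset.card_univ, Fintype.card_fin]
  have h1 := Finset.card_le_card hsub
  have h2 := Multiset.toFinset_card_le (legendre N).roots
  have h3 := (card_roots' (legendre N)).trans (natDegree_legendre_le N)
  have heq := Finset.eq_of_subset_of_card_le hsub (by omega)
  refine ⟨Multiset.toFinset_card_eq_card_iff_nodup.1 (by omega), by omega, fun x hx => ?_⟩
  rw [← Multiset.mem_toFinset, ← heq] at hx
  obtain ⟨i, -, rfl⟩ := Finset.mem_image.1 hx
  exact hb i

theorem length_sort_roots_legendre (N : ℕ) :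
    ((legendre N).roots.sort (· ≥ ·)).length = N := by
  rw [Multiset.length_sort, (card_roots_legendre N).2.1]

theorem legendreNode_eq_getElem (N : ℕ) (k : Fin N) :
    legendreNode N k = ((legendre N).roots.sort (· ≥ ·))[(k : ℕ)]'(by
      rw [length_sort_roots_legendre]; exact k.2) := by
  rw [legendreNode, List.getD_eq_getElem]

theorem legendreNode_mem_roots (N : ℕ) (k : Fin N) :
    legendreNode N k ∈ (legendre N).roots := by
  rw [legendreNode_eq_getElem, ← Multiset.mem_sort (r := (· ≥ ·))]
  exact List.getElem_mem _

theorem eval_legendreNode (N : ℕ) (k : Fin N) : (legendre N).eval (legendreNode N k) = 0 :=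
  (mem_roots (legendre_ne_zero N)).1 (legendreNode_mem_roots N k)

theorem legendreNode_mem_Ioo (N : ℕ) (k : Fin N) :
    -1 < legendreNode N k ∧ legendreNode N k < 1 :=
  (card_roots_legendre N).2.2 _ (legendreNode_mem_roots N k)

theorem exists_legendreNode_eq {N : ℕ} {x : ℝ} (hx : (legendre N).eval x = 0) :
    ∃ k, legendreNode N k = x := by
  have h : x ∈ (legendre N).roots.sort (· ≥ ·) := by
    rw [Multiset.mem_sort]
    exact (mem_roots (legendre_ne_zero N)).2 hx
  obtain ⟨i, hi, rfl⟩ := List.mem_iff_getElem.1 h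
  exact ⟨⟨i, by rwa [length_sort_roots_legendre] at hi⟩, legendreNode_eq_getElem _ _⟩

theorem strictAnti_legendreNode (N : ℕ) : StrictAnti (legendreNode N) := by
  intro i j hij
  have hp := List.pairwise_iff_getElem.1
    (Multiset.pairwise_sort (legendre N).roots (· ≥ ·)) i j
    (by rw [length_sort_roots_legendre]; exact i.2)
    (by rw [length_sort_roots_legendre]; exact j.2) hij
  rw [← legendreNode_eq_getElem, ← legendreNode_eq_getElem] at hp
  refine lt_of_le_of_ne hp fun h => ?_
  have hn : ((legendre N).roots.sort (· ≥ ·)).Nodup := by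
    rw [← Multiset.coe_nodup, Multiset.sort_eq]
    exact (card_roots_legendre N).1
  rw [legendreNode_eq_getElem, legendreNode_eq_getElem, hn.getElem_inj_iff] at h
  omega

/-- By parity both sides enumerate the same zero set increasingly, and a strictly increasing
enumeration is determined by its range. -/
theorem legendreNode_rev (N : ℕ) (k : Fin N) :
    legendreNode N k.rev = -legendreNode N k := by
  have h1 : StrictMono fun k : Fin N => legendreNode N k.rev :=
    fun i j hij => strictAnti_legendreNode N (Fin.rev_lt_rev.2 hij)
  have h2 : StrictMono fun k : Fin N => -legendreNode N k :=
    fun i j hij => neg_lt_neg (strictAnti_legendreNode N hij)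
  refine congrFun ((StrictMono.range_inj h1 h2).1 (Set.ext fun x => ⟨?_, ?_⟩)) k
  · rintro ⟨i, rfl⟩
    obtain ⟨j, hj⟩ := exists_legendreNode_eq (N := N) (x := -legendreNode N i.rev)
      (by rw [legendre_comp_neg, eval_legendreNode, mul_zero])
    exact ⟨j, by simp [hj]⟩
  · rintro ⟨i, rfl⟩
    obtain ⟨j, hj⟩ := exists_legendreNode_eq (N := N) (x := -legendreNode N i)
      (by rw [legendre_comp_neg, eval_legendreNode, mul_zero])
    exact ⟨j.rev, by simp [hj]⟩

theorem cos_thetaLeg (N : ℕ) (k : Fin N) : Real.cos (thetaLeg N k) = legendreNode N k :=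
  Real.cos_arccos (legendreNode_mem_Ioo N k).1.le (legendreNode_mem_Ioo N k).2.le

theorem thetaLeg_mem_Ioo (N : ℕ) (k : Fin N) : 0 < thetaLeg N k ∧ thetaLeg N k < Real.pi :=
  ⟨Real.arccos_pos.2 (legendreNode_mem_Ioo N k).2,
    Real.arccos_lt_pi.2 (legendreNode_mem_Ioo N k).1⟩

theorem strictMono_thetaLeg (N : ℕ) : StrictMono (thetaLeg N) := fun i j hij =>
  Real.arccos_lt_arccos (legendreNode_mem_Ioo N j).1.le (strictAnti_legendreNode N hij)
    (legendreNode_mem_Ioo N i).2.le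

theorem thetaLeg_rev (N : ℕ) (k : Fin N) : thetaLeg N k.rev = Real.pi - thetaLeg N k := by
  rw [thetaLeg, legendreNode_rev, Real.arccos_neg, thetaLeg]

theorem eval_cos_thetaLeg (N : ℕ) (k : Fin N) :
    (legendre N).eval (Real.cos (thetaLeg N k)) = 0 := by
  rw [cos_thetaLeg, eval_legendreNode]

theorem exists_thetaLeg_eq {N : ℕ} {t : ℝ} (h0 : 0 ≤ t) (h1 : t ≤ Real.pi)
    (ht : (legendre N).eval (Real.cos t) = 0) : ∃ k, thetaLeg N k = t := by
  obtain ⟨k, hk⟩ := exists_legendreNode_eq ht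
  exact ⟨k, by rw [thetaLeg, hk, Real.arccos_cos h0 h1]⟩

/-! ### Truncation error of the Taylor expansion -/

theorem iteratedDeriv_cos_eq_Phi (l : ℕ) (t : ℝ) :
    iteratedDeriv l Real.cos t = (-1) ^ ((l + 1) / 2) * Phi l t := by
  rcases Nat.even_or_odd' l with ⟨m, rfl | rfl⟩
  · rw [show (2 * m + 1) / 2 = m by omega, Real.iteratedDeriv_even_cos]
    simp [Phi]
  · rw [show (2 * m + 1 + 1) / 2 = m + 1 by omega, Real.iteratedDeriv_odd_cos]
    simp [Phi]

theorem abs_Phi_le_one (l : ℕ) (t : ℝ) : |Phi l t| ≤ 1 := by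
  unfold Phi
  split_ifs
  exacts [Real.abs_cos_le_one t, Real.abs_sin_le_one t]

/-- Taylor's theorem for the cosine. -/
theorem abs_cos_sub_taylor_le {L : ℕ} (hL : 1 ≤ L) (a b : ℝ) :
    |Real.cos b - ∑ l ∈ Finset.range L,
      (-1) ^ ((l + 1) / 2) * ((b - a) ^ l / (l.factorial : ℝ)) * Phi l a| ≤
      |b - a| ^ L / (L.factorial : ℝ) := by
  obtain ⟨n, rfl⟩ : ∃ n, L = n + 1 := ⟨L - 1, by omega⟩
  rcases eq_or_ne a b with rfl | hab
  · simp [Finset.sum_range_succ', Phi]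
  · obtain ⟨x, -, hx⟩ := taylor_mean_remainder_lagrange_iteratedDeriv (f := Real.cos) (n := n) hab
      Real.contDiff_cos.contDiffOn
    have hT : taylorWithinEval Real.cos n (Set.uIcc a b) a b = ∑ l ∈ Finset.range (n + 1),
        (-1) ^ ((l + 1) / 2) * ((b - a) ^ l / (l.factorial : ℝ)) * Phi l a := by
      rw [taylor_within_apply]
      refine Finset.sum_congr rfl fun l _ => ?_
      rw [iteratedDerivWithin_eq_iteratedDeriv (uniqueDiffOn_uIcc hab)
        Real.contDiff_cos.contDiffAt Set.left_mem_uIcc, iteratedDeriv_cos_eq_Phi, smul_eq_mul]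
      ring
    rw [← hT, hx, iteratedDeriv_cos_eq_Phi, abs_div, abs_mul, abs_mul, abs_pow, abs_pow]
    simp only [abs_neg, abs_one, one_pow, one_mul, Nat.abs_cast]
    gcongr
    exact mul_le_of_le_one_left (by positivity) (abs_Phi_le_one _ _)

/-- The truncation error of the transform, in terms of the distance of the Taylor centres to the
Legendre angles. -/
theorem norm_ndct_sub_ndctTaylor_le {𝕜 : Type*} [RCLike 𝕜] {N L : ℕ} (hL : 1 ≤ L)
    (θ : Fin N → ℝ) (c : Fin N → 𝕜) (k : Fin N) {B : ℝ}
    (hB : ((N : ℝ) - 1) * |thetaLeg N k - θ k| ≤ B) :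
    ‖ndct c k - ndctTaylor L θ c k‖ ≤ B ^ L / (L.factorial : ℝ) * norm1 c := by
  -- Swapping the sums turns the truncated transform into Taylor polynomials of `cos` at `n θ_k`,
  -- with increments `n δ_k`.
  have key : ndct c k - ndctTaylor L θ c k = ∑ n : Fin N, c n *
      ((Real.cos ((n : ℕ) * thetaLeg N k) - ∑ l ∈ Finset.range L, (-1) ^ ((l + 1) / 2) *
        (((n : ℕ) * thetaLeg N k - (n : ℕ) * θ k) ^ l / (l.factorial : ℝ)) *
          Phi l ((n : ℕ) * θ k) : ℝ) : 𝕜) := by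
    rw [ndct, ndctTaylor]
    simp_rw [Finset.mul_sum]
    rw [Finset.sum_comm, ← Finset.sum_sub_distrib]
    refine Finset.sum_congr rfl fun n _ => ?_
    rw [← cos_thetaLeg, Polynomial.Chebyshev.T_real_cos]
    push_cast
    rw [mul_sub, Finset.mul_sum]
    congr 1
    refine Finset.sum_congr rfl fun l _ => ?_
    rw [← mul_sub, mul_pow]
    ring
  rw [key, norm1, Finset.mul_sum]
  refine (norm_sum_le _ _).trans (Finset.sum_le_sum fun n _ => ?_)
  rw [norm_mul, mul_comm, RCLike.norm_ofReal]
  refine mul_le_mul_of_nonneg_right ((abs_cos_sub_taylor_le hL _ _).trans ?_) (norm_nonneg _)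
  have hn : ((n : ℕ) : ℝ) ≤ N - 1 := by
    have : ((n : ℕ) : ℝ) + 1 ≤ N := by exact_mod_cast n.2
    linarith
  gcongr
  rw [← mul_sub, abs_mul, Nat.abs_cast]
  exact (mul_le_mul_of_nonneg_right hn (abs_nonneg _)).trans hB

/-! ### Sturm comparison and the upper bound on the gaps -/

/-- Sturm comparison in Riccati form (Picone's identity): if `u'' + q u = 0` has consecutive zeros
`a < b`, then `w' + w ^ 2 + Q = 0` with `Q > q` has no solution on `[a, b]`. -/
theorem sturm_picone {u u₁ q w Q : ℝ → ℝ} {a b : ℝ} (hab : a < b)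
    (hu : ∀ t ∈ Icc a b, HasDerivAt u (u₁ t) t)
    (hu₁ : ∀ t ∈ Icc a b, HasDerivAt u₁ (-(q t * u t)) t)
    (hw : ∀ t ∈ Icc a b, HasDerivAt w (-(Q t + w t ^ 2)) t)
    (hq : ∀ t ∈ Icc a b, q t < Q t) (ha : u a = 0) (hb : u b = 0)
    (hne : ∀ t ∈ Ioo a b, u t ≠ 0) : False := by
  -- Picone's function vanishes at both ends, yet its derivative is a square plus `(Q - q) u²`,
  -- positive inside.
  have hF : ∀ t ∈ Icc a b, HasDerivAt (fun t => u t * u₁ t - u t ^ 2 * w t)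
      ((u₁ t - u t * w t) ^ 2 + (Q t - q t) * u t ^ 2) t := by
    intro t ht
    convert! ((hu t ht).mul (hu₁ t ht)).sub (((hu t ht).pow 2).mul (hw t ht)) using 1
    simp
    ring
  have hmono : StrictMonoOn (fun t => u t * u₁ t - u t ^ 2 * w t) (Icc a b) := by
    refine strictMonoOn_of_deriv_pos (convex_Icc a b)
      (fun t ht => (hF t ht).continuousAt.continuousWithinAt) fun t ht => ?_
    rw [interior_Icc] at ht
    have ht' := Ioo_subset_Icc_self ht
    rw [(hF t ht').deriv]
    have h1 : 0 < Q t - q t := sub_pos.2 (hq t ht')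
    have h2 : 0 < u t ^ 2 := by have := hne t ht; positivity
    positivity
  have := hmono (left_mem_Icc.2 hab.le) (right_mem_Icc.2 hab.le) hab
  simp [ha, hb] at this

/-- `u(t) = √(sin t) P_N(cos t)`, which satisfies `u'' + q u = 0`. -/
def legendreU (N : ℕ) (t : ℝ) : ℝ := √(Real.sin t) * (legendre N).eval (Real.cos t)

/-- The derivative of `legendreU`. -/
def legendreU' (N : ℕ) (t : ℝ) : ℝ :=
  √(Real.sin t) * (-Real.sin t * (derivative (legendre N)).eval (Real.cos t) +
    Real.cos t / (2 * Real.sin t) * (legendre N).eval (Real.cos t))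

/-- The coefficient `q` in the normal form of the Legendre equation. -/
def legendreQ (N : ℕ) (t : ℝ) : ℝ := ((N : ℝ) + 1 / 2) ^ 2 + 1 / (4 * Real.sin t ^ 2)

theorem hasDerivAt_sqrt_sin {t : ℝ} (ht : 0 < Real.sin t) :
    HasDerivAt (fun t => √(Real.sin t))
      (√(Real.sin t) * (Real.cos t / (2 * Real.sin t))) t := by
  convert! (Real.hasDerivAt_sin t).sqrt ht.ne' using 1
  have h1 : 0 < √(Real.sin t) := Real.sqrt_pos.2 ht
  have h2 : √(Real.sin t) ^ 2 = Real.sin t := Real.sq_sqrt ht.le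
  field_simp
  rw [h2]
  ring

theorem hasDerivAt_eval_cos (p : ℝ[X]) (t : ℝ) :
    HasDerivAt (fun t => p.eval (Real.cos t))
      (-Real.sin t * (derivative p).eval (Real.cos t)) t := by
  convert! (p.hasDerivAt (Real.cos t)).comp t (Real.hasDerivAt_cos t) using 1
  ring

theorem hasDerivAt_legendreU (N : ℕ) {t : ℝ} (ht : 0 < Real.sin t) :
    HasDerivAt (legendreU N) (legendreU' N t) t := by
  convert! (hasDerivAt_sqrt_sin ht).mul (hasDerivAt_eval_cos (legendre N) t) using 1
  rw [legendreU']
  ring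

theorem hasDerivAt_legendreU' (N : ℕ) {t : ℝ} (ht : 0 < Real.sin t) :
    HasDerivAt (legendreU' N) (-(legendreQ N t * legendreU N t)) t := by
  have hs := Real.hasDerivAt_sin t
  have hc := Real.hasDerivAt_cos t
  convert! (hasDerivAt_sqrt_sin ht).mul ((hs.neg.mul
    (hasDerivAt_eval_cos (derivative (legendre N)) t)).add
      ((hc.div (hs.const_mul 2) (by positivity)).mul
        (hasDerivAt_eval_cos (legendre N) t))) using 1
  have h := legendre_ode N (Real.cos t)
  have h2 := Real.cos_sq' t
  rw [legendreQ, legendreU]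
  simp only [Pi.neg_apply, Pi.mul_apply, Pi.add_apply, Pi.div_apply]
  set S := Real.sin t
  set C := Real.cos t
  set r := √S
  set p0 := (legendre N).eval C
  set p1 := (derivative (legendre N)).eval C
  set p2 := (derivative (derivative (legendre N))).eval C
  have e : S ^ 2 * p2 = 2 * C * p1 - N * (N + 1) * p0 := by
    rw [h2] at h; linear_combination h
  field_simp
  linear_combination (-16 * r * S ^ 2) * e + 4 * r * p0 * h2

/-- Consecutive zeros of `P_N(cos t)` are at most `π / (N + 1/2)` apart. -/
theorem sub_le_of_consecutive (N : ℕ) {a b : ℝ} (ha : 0 < a) (hb : b < Real.pi)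
    (hne : ∀ t ∈ Ioo a b, (legendre N).eval (Real.cos t) ≠ 0) :
    b - a ≤ Real.pi / ((N : ℝ) + 1 / 2) := by
  by_contra! hlt
  set l : ℝ := (N : ℝ) + 1 / 2 with hl
  have hl0 : 0 < l := by positivity
  have hpl : 0 < Real.pi / l := by positivity
  -- Centring a window of length `π / l` keeps it strictly inside `(a, b)`, so `u'/u` is defined on
  -- the closed window. The sine plays the role of the function with consecutive zeros.
  set a' := a + (b - a - Real.pi / l) / 2 with ha'
  have hsin : ∀ t ∈ Icc a' (a' + Real.pi / l), 0 < Real.sin t := fun t ht =>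
    Real.sin_pos_of_pos_of_lt_pi (by linarith [ht.1]) (by linarith [ht.2])
  have hU : ∀ t ∈ Icc a' (a' + Real.pi / l), legendreU N t ≠ 0 := fun t ht =>
    mul_ne_zero (Real.sqrt_pos.2 (hsin t ht)).ne'
      (hne t ⟨by linarith [ht.1], by linarith [ht.2]⟩)
  have hlin : ∀ t : ℝ, HasDerivAt (fun t => l * (t - a')) l t := fun t => by
    simpa using ((hasDerivAt_id t).sub_const a').const_mul l
  refine sturm_picone (u := fun t => Real.sin (l * (t - a')))
    (u₁ := fun t => l * Real.cos (l * (t - a'))) (q := fun _ => l ^ 2)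
    (w := fun t => legendreU' N t / legendreU N t) (Q := legendreQ N)
    (a := a') (b := a' + Real.pi / l) (by linarith) ?_ ?_ ?_ ?_ (by simp) ?_ ?_
  · intro t _
    convert! (hlin t).sin using 1
    ring
  · intro t _
    convert! (hlin t).cos.const_mul l using 1
    ring
  · intro t ht
    convert! (hasDerivAt_legendreU' N (hsin t ht)).div (hasDerivAt_legendreU N (hsin t ht))
      (hU t ht) using 1
    have := hU t ht
    field_simp
    ring
  · intro t ht
    have := hsin t ht
    rw [legendreQ, ← hl]
    have : 0 < 1 / (4 * Real.sin t ^ 2) := by positivity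
    linarith
  · have : l * (a' + Real.pi / l - a') = Real.pi := by field_simp; ring
    simp only [this, Real.sin_pi]
  · intro t ht
    refine (Real.sin_pos_of_pos_of_lt_pi (mul_pos hl0 (sub_pos.2 ht.1)) ?_).ne'
    have : t - a' < Real.pi / l := by linarith [ht.2]
    rwa [lt_div_iff₀' hl0] at this

/-! ### Comparison with a phase function: the lower bound on the gaps -/

/-- The phase `φ(t) = l (t - π/2) - cot t / (8 l)`. -/
def phase (l t : ℝ) : ℝ := l * (t - Real.pi / 2) - Real.cos t / Real.sin t / (8 * l)

/-- The derivative of the phase. -/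
def phase' (l t : ℝ) : ℝ := l + 1 / (8 * l * Real.sin t ^ 2)

/-- The second derivative of the phase. -/
def phase'' (l t : ℝ) : ℝ := -(Real.cos t / (4 * l * Real.sin t ^ 3))

/-- The third derivative of the phase. -/
def phase''' (l t : ℝ) : ℝ := (3 - 2 * Real.sin t ^ 2) / (4 * l * Real.sin t ^ 4)

theorem hasDerivAt_phase {l t : ℝ} (hl : 0 < l) (ht : 0 < Real.sin t) :
    HasDerivAt (phase l) (phase' l t) t := by
  convert! (((hasDerivAt_id t).sub_const (Real.pi / 2)).const_mul l).sub
    (((Real.hasDerivAt_cos t).div (Real.hasDerivAt_sin t) ht.ne').div_const (8 * l)) using 1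
  rw [phase']
  field_simp
  linear_combination -Real.sin_sq_add_cos_sq t

theorem hasDerivAt_phase' {l t : ℝ} (hl : 0 < l) (ht : 0 < Real.sin t) :
    HasDerivAt (phase' l) (phase'' l t) t := by
  convert! ((((Real.hasDerivAt_sin t).pow 2).const_mul (8 * l)).fun_inv
    (by simp only [Pi.pow_apply]; positivity)).const_add l using 1
  · ext; simp [phase']
  · simp only [phase'', Pi.pow_apply]
    field_simp
    ring

theorem hasDerivAt_phase'' {l t : ℝ} (hl : 0 < l) (ht : 0 < Real.sin t) :
    HasDerivAt (phase'' l) (phase''' l t) t := by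
  convert! ((Real.hasDerivAt_cos t).div (((Real.hasDerivAt_sin t).pow 3).const_mul (4 * l))
    (by simp only [Pi.pow_apply]; positivity)).neg using 1
  simp only [phase''', Pi.pow_apply]
  have := Real.sin_sq_add_cos_sq t
  field_simp
  norm_num
  linear_combination (-3 * Real.sin t ^ 2) * this

theorem phase'_pos {l t : ℝ} (hl : 0 < l) : 0 < phase' l t := by
  unfold phase'; positivity

theorem phase_strictMonoOn {l : ℝ} (hl : 0 < l) : StrictMonoOn (phase l) (Ioo 0 Real.pi) := by
  have h : ∀ t ∈ Ioo 0 Real.pi, HasDerivAt (phase l) (phase' l t) t := fun t ht =>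
    hasDerivAt_phase hl (Real.sin_pos_of_pos_of_lt_pi ht.1 ht.2)
  refine strictMonoOn_of_deriv_pos (convex_Ioo _ _)
    (fun t ht => (h t ht).continuousAt.continuousWithinAt) fun t ht => ?_
  rw [interior_Ioo] at ht
  rw [(h t ht).deriv]
  exact phase'_pos hl

theorem phase_pi_sub (l t : ℝ) : phase l (Real.pi - t) = -phase l t := by
  rw [phase, phase, Real.cos_pi_sub, Real.sin_pi_sub]
  ring

/-- The coefficient of the equation solved by `φ'^(-1/2) sin(φ + c)`. -/
def phaseQ (l t : ℝ) : ℝ :=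
  phase' l t ^ 2 + phase''' l t / (2 * phase' l t) - 3 / 4 * (phase'' l t / phase' l t) ^ 2

/-- `φ'` is the first-order expansion of `√q` in `1/l²`, so `φ'²` exceeds `q` by a positive square.
The remaining terms are nonnegative: by `φ' ≥ l` this reduces to `8 l² sin² t (3 - 2 sin² t) ≥ 3
cos² t`, which follows from `h`. -/
theorem lt_phaseQ {l t : ℝ} (hl : 0 < l) (ht : 0 < Real.sin t)
    (h : 1 ≤ 8 * l ^ 2 * Real.sin t ^ 2) :
    l ^ 2 + 1 / (4 * Real.sin t ^ 2) < phaseQ l t := by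
  have hf : 0 < phase' l t := phase'_pos hl
  have e1 : phase' l t ^ 2 = l ^ 2 + 1 / (4 * Real.sin t ^ 2) +
      1 / (64 * l ^ 2 * Real.sin t ^ 4) := by
    rw [phase']; field_simp; ring
  have e2 : phase''' l t / (2 * phase' l t) - 3 / 4 * (phase'' l t / phase' l t) ^ 2 =
      (2 * phase' l t * phase''' l t - 3 * phase'' l t ^ 2) / (4 * phase' l t ^ 2) := by
    field_simp
    ring
  have hs1 : Real.sin t ^ 2 ≤ 1 := Real.sin_sq_le_one t
  have h3 : 0 ≤ phase''' l t := by
    rw [phase''']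
    have : 0 ≤ 3 - 2 * Real.sin t ^ 2 := by linarith
    positivity
  have h4 : l ≤ phase' l t := by
    rw [phase']; linarith [show 0 ≤ 1 / (8 * l * Real.sin t ^ 2) by positivity]
  have h5 : 3 * phase'' l t ^ 2 ≤ 2 * l * phase''' l t := by
    rw [phase'', phase''', neg_sq, div_pow, Real.cos_sq', mul_div_assoc', mul_div_assoc',
      div_le_div_iff₀ (by positivity) (by positivity)]
    have h6 : 0 ≤ 8 * l ^ 2 * Real.sin t ^ 2 * (3 - 2 * Real.sin t ^ 2) -
        3 * (1 - Real.sin t ^ 2) := by nlinarith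
    have h7 : 0 ≤ 4 * l * Real.sin t ^ 4 * (8 * l ^ 2 * Real.sin t ^ 2 *
      (3 - 2 * Real.sin t ^ 2) - 3 * (1 - Real.sin t ^ 2)) := by positivity
    linarith
  have h8 : 0 ≤ 2 * phase' l t * phase''' l t - 3 * phase'' l t ^ 2 := by nlinarith
  rw [phaseQ, add_sub_assoc, e2]
  have h9 : 0 < 1 / (64 * l ^ 2 * Real.sin t ^ 4) := by positivity
  have h10 : 0 ≤ (2 * phase' l t * phase''' l t - 3 * phase'' l t ^ 2) / (4 * phase' l t ^ 2) := by
    positivity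
  linarith

/-- The phase grows by at least `π` between zeros of `P_N(cos t)`. -/
theorem pi_le_phase_sub_of_consecutive (N : ℕ) {a b : ℝ} (ha : 0 < a) (hab : a < b)
    (hb : b < Real.pi)
    (hs : ∀ t ∈ Icc a b, 1 ≤ 8 * ((N : ℝ) + 1 / 2) ^ 2 * Real.sin t ^ 2)
    (h0 : (legendre N).eval (Real.cos a) = 0) (h1 : (legendre N).eval (Real.cos b) = 0)
    (hne : ∀ t ∈ Ioo a b, (legendre N).eval (Real.cos t) ≠ 0) :
    Real.pi ≤ phase ((N : ℝ) + 1 / 2) b - phase ((N : ℝ) + 1 / 2) a := by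
  by_contra! hlt
  set l : ℝ := (N : ℝ) + 1 / 2 with hl
  have hl0 : 0 < l := by positivity
  have hsin : ∀ t ∈ Icc a b, 0 < Real.sin t := fun t ht =>
    Real.sin_pos_of_pos_of_lt_pi (by linarith [ht.1]) (by linarith [ht.2])
  -- This shift centres the range of `φ + c` at `π/2`; having length below `π`, the range stays in
  -- `(0, π)`.
  set c := (Real.pi - (phase l b + phase l a)) / 2 with hc
  have hmono := (phase_strictMonoOn hl0).monotoneOn
  have hsc : ∀ t ∈ Icc a b, Real.sin (phase l t + c) ≠ 0 := fun t ht => by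
    have h2 := hmono ⟨ha, hab.trans hb⟩ ⟨ha.trans_le ht.1, ht.2.trans_lt hb⟩ ht.1
    have h3 := hmono ⟨ha.trans_le ht.1, ht.2.trans_lt hb⟩ ⟨ha.trans hab, hb⟩ ht.2
    exact (Real.sin_pos_of_pos_of_lt_pi (by linarith) (by linarith)).ne'
  -- Here `w` is the logarithmic derivative of `φ'^(-1/2) sin(φ + c)`.
  refine sturm_picone hab (u := legendreU N) (u₁ := legendreU' N) (q := legendreQ N)
    (w := fun t => -(phase'' l t / (2 * phase' l t)) +
      phase' l t * (Real.cos (phase l t + c) / Real.sin (phase l t + c))) (Q := phaseQ l)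
    (fun t ht => hasDerivAt_legendreU N (hsin t ht))
    (fun t ht => hasDerivAt_legendreU' N (hsin t ht)) ?_
    (fun t ht => lt_phaseQ hl0 (hsin t ht) (hs t ht)) (by rw [legendreU, h0, mul_zero])
    (by rw [legendreU, h1, mul_zero]) fun t ht =>
      mul_ne_zero (Real.sqrt_pos.2 (hsin t (Ioo_subset_Icc_self ht))).ne' (hne t ht)
  intro t ht
  have hf := phase'_pos (t := t) hl0
  have hS := hsc t ht
  have d0 := (hasDerivAt_phase hl0 (hsin t ht)).add_const c
  have d1 := hasDerivAt_phase' hl0 (hsin t ht)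
  have d2 := hasDerivAt_phase'' hl0 (hsin t ht)
  convert! ((d2.div (d1.const_mul 2) (by positivity)).neg).add
    (d1.mul (d0.cos.div d0.sin hS)) using 1
  simp only [phaseQ, Pi.div_apply]
  field_simp
  ring

/-! ### Legendre angles against the two grids -/

theorem ne_zero_between_thetaLeg {N i : ℕ} (hi : i + 1 < N) :
    ∀ t ∈ Ioo (thetaLeg N ⟨i, by omega⟩) (thetaLeg N ⟨i + 1, hi⟩),
      (legendre N).eval (Real.cos t) ≠ 0 := by
  intro t ht h0
  obtain ⟨k, rfl⟩ := exists_thetaLeg_eq ((thetaLeg_mem_Ioo N _).1.trans ht.1).le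
    (ht.2.trans (thetaLeg_mem_Ioo N _).2).le h0
  have h1 := (strictMono_thetaLeg N).lt_iff_lt.1 ht.1
  have h2 := (strictMono_thetaLeg N).lt_iff_lt.1 ht.2
  simp only [Fin.lt_def] at h1 h2
  omega

theorem sub_le_mul_of_step_le {N : ℕ} {f : Fin N → ℝ} {D : ℝ} {i j : ℕ} (hij : i ≤ j) (hj : j < N)
    (h : ∀ m (_ : i ≤ m) (_ : m < j), f ⟨m + 1, by omega⟩ - f ⟨m, by omega⟩ ≤ D) :
    f ⟨j, hj⟩ - f ⟨i, by omega⟩ ≤ ((j : ℝ) - i) * D := by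
  induction j, hij using Nat.le_induction with
  | base => simp
  | succ j hij ih =>
    have h1 := ih (by omega) fun m h1 h2 => h m h1 (by omega)
    have h2 := h j hij (by omega)
    push_cast
    linarith

theorem mul_le_sub_of_le_step {N : ℕ} {f : Fin N → ℝ} {D : ℝ} {i j : ℕ} (hij : i ≤ j) (hj : j < N)
    (h : ∀ m (_ : i ≤ m) (_ : m < j), D ≤ f ⟨m + 1, by omega⟩ - f ⟨m, by omega⟩) :
    ((j : ℝ) - i) * D ≤ f ⟨j, hj⟩ - f ⟨i, by omega⟩ := by
  have := sub_le_mul_of_step_le (f := fun k => -f k) (D := -D) hij hj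
    fun m h1 h2 => by linarith [h m h1 h2]
  linarith

/-- In the left half, the Chebyshev-like grid bounds the Legendre angles from below. -/
theorem thetaChebStar_le_thetaLeg {N : ℕ} (k : Fin N) (hk : 2 * (k : ℕ) + 1 ≤ N) :
    thetaChebStar N k ≤ thetaLeg N k := by
  have hrev := thetaLeg_rev N k
  -- Summing the gaps from `k` to its mirror index `N - 1 - k` bounds `π - 2 θ_k`.
  have h := sub_le_mul_of_step_le (f := thetaLeg N) (D := Real.pi / ((N : ℝ) + 1 / 2))
    (i := k) (j := N - (k + 1)) (by omega) (by omega) fun m h1 h2 =>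
      sub_le_of_consecutive N (thetaLeg_mem_Ioo N _).1 (thetaLeg_mem_Ioo N _).2
        (ne_zero_between_thetaLeg (by omega))
  rw [show (⟨N - ((k : ℕ) + 1), by omega⟩ : Fin N) = k.rev from rfl, hrev, Fin.eta,
    Nat.cast_sub (by omega)] at h
  push_cast at h
  have e : thetaChebStar N k = (Real.pi -
      ((N : ℝ) - ((k : ℕ) + 1) - (k : ℕ)) * (Real.pi / ((N : ℝ) + 1 / 2))) / 2 := by
    rw [thetaChebStar]
    field_simp
    ring
  rw [e]
  linarith

/-- Summing the phase increments from `k` to its mirror index bounds `-2 φ(θ_k)` from below, since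
`φ` is odd about `π/2`. -/
theorem phase_thetaLeg_le {N : ℕ} (k : Fin N) (hk : 2 * (k : ℕ) + 1 ≤ N) :
    phase ((N : ℝ) + 1 / 2) (thetaLeg N k) ≤ -(((N : ℝ) - 1 - 2 * (k : ℕ)) / 2 * Real.pi) := by
  have hN : 0 < N := k.pos
  have h0 : 3 / 4 * Real.pi / ((N : ℝ) + 1 / 2) ≤ thetaLeg N ⟨0, hN⟩ := by
    simpa [thetaChebStar] using thetaChebStar_le_thetaLeg (⟨0, hN⟩ : Fin N) (by simp; omega)
  have hrev0 := thetaLeg_rev N ⟨0, hN⟩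
  have hbound : ∀ t ∈ Icc (thetaLeg N ⟨0, hN⟩) (Real.pi - thetaLeg N ⟨0, hN⟩),
      1 ≤ 8 * ((N : ℝ) + 1 / 2) ^ 2 * Real.sin t ^ 2 := by
    intro t ht
    -- Jordan's inequality `sin x ≥ 2x/π` at distance at least `3π/(4l)` from `0` and `π`; then `8
    -- l² sin² t ≥ 18`.
    have hsin : 3 / 2 / ((N : ℝ) + 1 / 2) ≤ Real.sin t := by
      have aux : ∀ x, 3 / 4 * Real.pi / ((N : ℝ) + 1 / 2) ≤ x → x ≤ Real.pi / 2 →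
          3 / 2 / ((N : ℝ) + 1 / 2) ≤ Real.sin x := by
        intro x h1 h2
        refine le_trans ?_ (Real.mul_le_sin (le_trans (by positivity) h1) h2)
        refine le_trans (le_of_eq ?_) (mul_le_mul_of_nonneg_left h1 (by positivity))
        have := Real.pi_ne_zero
        field_simp
        norm_num
      rcases le_total t (Real.pi / 2) with h | h
      · exact aux t (h0.trans ht.1) h
      · rw [← Real.sin_pi_sub]
        exact aux _ (by linarith [ht.2]) (by linarith)
    have h1 : (3 / 2 / ((N : ℝ) + 1 / 2)) ^ 2 ≤ Real.sin t ^ 2 := by gcongr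
    calc (1 : ℝ) ≤ 8 * ((N : ℝ) + 1 / 2) ^ 2 * (3 / 2 / ((N : ℝ) + 1 / 2)) ^ 2 := by
          field_simp; norm_num
      _ ≤ _ := by gcongr
  have h := mul_le_sub_of_le_step (f := fun k => phase ((N : ℝ) + 1 / 2) (thetaLeg N k))
    (D := Real.pi) (i := k) (j := N - (k + 1)) (by omega) (by omega) fun m h1 h2 => by
      refine pi_le_phase_sub_of_consecutive N (thetaLeg_mem_Ioo N _).1
        (strictMono_thetaLeg N (by simp [Fin.lt_def])) (thetaLeg_mem_Ioo N _).2
        (fun t ht => hbound t ⟨le_trans ?_ ht.1, ht.2.trans ?_⟩) (eval_cos_thetaLeg N _)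
        (eval_cos_thetaLeg N _) (ne_zero_between_thetaLeg (by omega))
      · exact (strictMono_thetaLeg N).monotone (by simp [Fin.le_def])
      · rw [← hrev0]
        exact (strictMono_thetaLeg N).monotone (by simp [Fin.le_def]; omega)
  simp only [show (⟨N - ((k : ℕ) + 1), by omega⟩ : Fin N) = k.rev from rfl, thetaLeg_rev,
    phase_pi_sub, Fin.eta] at h
  rw [Nat.cast_sub (by omega)] at h
  push_cast at h
  linarith

/-- Solving the phase bound for `θ_k` leaves the excess `cot θ_k / (8 l²)`; the constant `6π` comes
from `cot t ≤ 1/t` and `θ_k ≥ 3π/(4l)`. -/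
theorem thetaLeg_le_thetaChebStar_add {N : ℕ} (k : Fin N) (hk : 2 * (k : ℕ) + 1 ≤ N) :
    thetaLeg N k ≤ thetaChebStar N k + 1 / (6 * Real.pi * ((N : ℝ) + 1 / 2)) := by
  have hp := Real.pi_pos
  have h1 := phase_thetaLeg_le k hk
  have h2 := thetaChebStar_le_thetaLeg k hk
  have hrev := thetaLeg_rev N k
  have h3 : thetaLeg N k ≤ thetaLeg N k.rev :=
    (strictMono_thetaLeg N).monotone (by rw [Fin.le_def, Fin.val_rev]; omega)
  have h4 : thetaLeg N k ≤ Real.pi / 2 := by linarith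
  set l : ℝ := (N : ℝ) + 1 / 2 with hl
  have hl0 : 0 < l := by positivity
  have h5 : 3 / 4 * Real.pi / l ≤ thetaLeg N k := by
    refine le_trans ?_ h2
    rw [thetaChebStar]
    gcongr
    linarith [Nat.cast_nonneg (α := ℝ) (k : ℕ)]
  set t := thetaLeg N k with ht
  have ht0 : 0 < t := (thetaLeg_mem_Ioo N k).1
  have hcot : Real.cos t / Real.sin t ≤ 1 / t := by
    rcases h4.eq_or_lt with h | h
    · rw [h, Real.cos_pi_div_two, zero_div]; positivity
    · have h6 := Real.le_tan ht0.le h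
      rw [← inv_div, ← Real.tan_eq_sin_div_cos, ← one_div]
      exact one_div_le_one_div_of_le ht0 h6
  have h7 : 1 / t ≤ 1 / (3 / 4 * Real.pi / l) := one_div_le_one_div_of_le (by positivity) h5
  have h8 : Real.cos t / Real.sin t / (8 * l) ≤ 1 / (3 / 4 * Real.pi / l) / (8 * l) :=
    div_le_div_of_nonneg_right (hcot.trans h7) (by positivity)
  have h9 : 1 / (3 / 4 * Real.pi / l) / (8 * l) = l * (1 / (6 * Real.pi * l)) := by
    field_simp; norm_num
  have h10 : l * thetaChebStar N k = ((k : ℕ) + 3 / 4) * Real.pi := by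
    rw [thetaChebStar, ← hl]; field_simp
  rw [phase] at h1
  have h11 : l * t ≤ l * (thetaChebStar N k + 1 / (6 * Real.pi * l)) := by
    have : l * (Real.pi / 2) = (N : ℝ) * Real.pi / 2 + Real.pi / 4 := by rw [hl]; ring
    rw [mul_add, h10, ← h9]
    linarith
  exact le_of_mul_le_mul_left h11 hl0

theorem thetaChebStar_rev {N : ℕ} (k : Fin N) :
    thetaChebStar N k.rev = Real.pi - thetaChebStar N k := by
  rw [thetaChebStar, thetaChebStar, Fin.val_rev, Nat.cast_sub (by omega)]
  push_cast
  field_simp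
  ring

theorem thetaCheb1_rev {N : ℕ} (k : Fin N) :
    thetaCheb1 N k.rev = Real.pi - thetaCheb1 N k := by
  have : (N : ℝ) ≠ 0 := by exact_mod_cast k.pos.ne'
  rw [thetaCheb1, thetaCheb1, Fin.val_rev, Nat.cast_sub (by omega)]
  push_cast
  field_simp
  ring

/-- A bound on the distance to a symmetric grid has to be checked on the left half only. -/
theorem abs_thetaLeg_sub_le_of_left_half {N : ℕ} {θ : Fin N → ℝ} {B : ℝ}
    (hθ : ∀ k, θ k.rev = Real.pi - θ k)
    (h : ∀ k : Fin N, 2 * (k : ℕ) + 1 ≤ N → |thetaLeg N k - θ k| ≤ B) (k : Fin N) :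
    |thetaLeg N k - θ k| ≤ B := by
  rcases le_total (2 * (k : ℕ) + 1) N with hk | hk
  · exact h k hk
  · have := h k.rev (by rw [Fin.val_rev]; omega)
    rwa [thetaLeg_rev, hθ, sub_sub_sub_cancel_left, abs_sub_comm] at this

theorem abs_thetaLeg_sub_thetaChebStar_le {N : ℕ} (k : Fin N) :
    |thetaLeg N k - thetaChebStar N k| ≤ 1 / (6 * Real.pi * ((N : ℝ) + 1 / 2)) := by
  refine abs_thetaLeg_sub_le_of_left_half thetaChebStar_rev (fun k hk => ?_) k
  rw [abs_of_nonneg (sub_nonneg.2 (thetaChebStar_le_thetaLeg k hk))]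
  linarith [thetaLeg_le_thetaChebStar_add k hk]

theorem abs_thetaLeg_sub_thetaCheb1_le {N : ℕ} (k : Fin N) :
    |thetaLeg N k - thetaCheb1 N k| ≤
      (Real.pi / 4 + 1 / (6 * Real.pi)) / ((N : ℝ) + 1 / 2) := by
  refine abs_thetaLeg_sub_le_of_left_half thetaCheb1_rev (fun k hk => ?_) k
  have hN : (0 : ℝ) < N := by exact_mod_cast k.pos
  have hk' : 2 * ((k : ℕ) : ℝ) + 1 ≤ N := by exact_mod_cast hk
  -- In the left half the last factor lies in `[0, 1]`, so both displacements are nonnegative and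
  -- add up.
  have e : thetaChebStar N k - thetaCheb1 N k =
      Real.pi / 4 / ((N : ℝ) + 1 / 2) * (((N : ℝ) - 1 - 2 * (k : ℕ)) / N) := by
    rw [thetaChebStar, thetaCheb1]
    field_simp
    ring
  have h0 : 0 ≤ ((N : ℝ) - 1 - 2 * (k : ℕ)) / N := div_nonneg (by linarith) hN.le
  have h1 : ((N : ℝ) - 1 - 2 * (k : ℕ)) / N ≤ 1 := by
    rw [div_le_one hN]
    linarith [Nat.cast_nonneg (α := ℝ) (k : ℕ)]
  have hp : 0 ≤ Real.pi / 4 / ((N : ℝ) + 1 / 2) := by positivity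
  have h2 := mul_nonneg hp h0
  have h3 := mul_le_of_le_one_right hp h1
  have h4 := thetaChebStar_le_thetaLeg k hk
  have h5 := thetaLeg_le_thetaChebStar_add k hk
  rw [abs_of_nonneg (by linarith), add_div, div_div 1]
  linarith

end NDCT

end

theorem corollary3 {𝕜 : Type*} [RCLike 𝕜] (N L : ℕ) (hL : 1 ≤ L) (c : Fin N → 𝕜) :
    (∀ k : Fin N, ‖NDCT.ndct c k - NDCT.ndctTaylor L (NDCT.thetaCheb1 N) c k‖ ≤
      (0.83845 : ℝ) ^ L / (L.factorial : ℝ) * NDCT.norm1 c) ∧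
    (∀ k : Fin N, ‖NDCT.ndct c k - NDCT.ndctTaylor L (NDCT.thetaChebStar N) c k‖ ≤
      1 / ((6 * Real.pi) ^ L * (L.factorial : ℝ)) * NDCT.norm1 c) := by
  have key : ∀ (k : Fin N) {d C : ℝ}, 0 ≤ C → |d| ≤ C / ((N : ℝ) + 1 / 2) →
      ((N : ℝ) - 1) * |d| ≤ C := by
    intro k d C hC hd
    rw [le_div_iff₀ (by positivity)] at hd
    nlinarith [abs_nonneg d]
  refine ⟨fun k => NDCT.norm_ndct_sub_ndctTaylor_le hL _ c k ?_, fun k => ?_⟩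
  · refine (key k (by positivity) (NDCT.abs_thetaLeg_sub_thetaCheb1_le k)).trans ?_
    -- Six decimals of `π` are needed: `π/4 + 1/(6π)` is below `0.83845` by only about `2·10⁻⁷`.
    have h1 := Real.pi_gt_d6
    have h2 := Real.pi_lt_d6
    have h3 : 1 / (6 * Real.pi) ≤ 1 / (6 * 3.141592) := by gcongr
    have h4 : (1 : ℝ) / (6 * 3.141592) ≤ 0.0530517 := by norm_num
    linarith
  · have h := NDCT.norm_ndct_sub_ndctTaylor_le hL (NDCT.thetaChebStar N) c k
      (key k (C := 1 / (6 * Real.pi)) (by positivity)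
        (by rw [div_div]; exact NDCT.abs_thetaLeg_sub_thetaChebStar_le k))
    rwa [div_pow, one_pow, div_div] at h
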